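/- A finite simple graph $G$ is $2$-admissible if it has a spanning tree $T$ with $d_T(u,v)\le 2\,d_G(u,v)$ for all vertices $u,v$. It is $P_4$-tidy if for every induced path $P$ on four vertices of $G$ there is at most one vertex $v\in V(G)\setminus V(P)$ such that $V(P)\cup\{v\}$ induces at least two $P_4$'s in $G$. **Theorem.** $2$-admissibility can be decided in $O(n)$ time for $P_4$-tidy graphs with $n$ vertices. Precisely: there are a single program for a unit-cost random access machine (instructions: load a constant, add, truncated subtract, indirect load and store, jump, jump on comparison, halt with answer yes or no) and a constant $c$ such that, for every $n$ and every $P_4$-tidy graph $G$ with vertex set $\{0,\dots,n-1\}$, when the program is started on any adjacency-list representation of $G$, it halts after at most $c(n+1)$ steps, answers yes if and only if $G$ is $2$-admissible, and during the whole computation holds only numbers at most $(n+2)^c$ in its registers and memory cells (words of $O(\log n)$ bits). Here an adjacency-list representation of $G$ consists of the number $n$, a table of $n+1$ addresses, and then the lists of neighbours of the vertices $0,\dots,n-1$ one after the other, each list in arbitrary order; the list of $v$ occupies the addresses from the $v$-th table entry up to, but not including, the $(v+1)$-st (so that the degree of a vertex can be read in constant time). -/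

import Mathlib

/-! ### Tree spanners and admissibility -/

/-- `T` is a tree `t`-spanner of `G`: a spanning tree of `G` in which the distance between any two
vertices is at most `t` times their distance in `G`. -/
def SimpleGraph.IsTreeSpanner {V : Type*} (G T : SimpleGraph V) (t : ℕ) : Prop :=
  T ≤ G ∧ T.IsTree ∧ ∀ u v : V, T.dist u v ≤ t * G.dist u v

/-- `G` is `t`-admissible: it has a tree `t`-spanner. -/
def SimpleGraph.IsAdmissible {V : Type*} (G : SimpleGraph V) (t : ℕ) : Prop :=
  ∃ T : SimpleGraph V, G.IsTreeSpanner T t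

/-! ### `P₄`-tidy graphs -/

/-- The vertex set `W` induces a path on four vertices in `G`. -/
def SimpleGraph.InducesP4 {V : Type*} (G : SimpleGraph V) (W : Finset V) : Prop :=
  Nonempty (G.induce (W : Set V) ≃g SimpleGraph.pathGraph 4)

/-- The number of induced `P₄`'s of `G` all of whose vertices lie in `U`. -/
noncomputable def SimpleGraph.numP4 {V : Type*} (G : SimpleGraph V) (U : Finset V) : ℕ :=
  Set.ncard {W : Finset V | W ⊆ U ∧ G.InducesP4 W}

/-- `G` is `P₄`-tidy: for every induced `P₄` of `G`, with vertex set `P`, there is at most one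
vertex `v` outside `P` such that `P ∪ {v}` induces at least two `P₄`'s. -/
def SimpleGraph.IsP4Tidy {V : Type*} [DecidableEq V] (G : SimpleGraph V) : Prop :=
  ∀ P : Finset V, G.InducesP4 P → ∀ v w : V, v ∉ P → w ∉ P →
    2 ≤ G.numP4 (insert v P) → 2 ≤ G.numP4 (insert w P) → v = w

/-! ### Random access machines -/

namespace RAM

/-- Instructions of a random access machine with registers and an addressable memory, all of whose
cells hold natural numbers. Each instruction takes one unit of time. -/
inductive Instr : Type
  /-- `reg d := k` -/
  | const (d k : ℕ)
  /-- `reg d := reg a + reg b` -/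
  | add (d a b : ℕ)
  /-- `reg d := reg a - reg b`, truncated at `0` -/
  | sub (d a b : ℕ)
  /-- `reg d := mem (reg a)` -/
  | load (d a : ℕ)
  /-- `mem (reg a) := reg s` -/
  | store (a s : ℕ)
  /-- continue at instruction `l` -/
  | jump (l : ℕ)
  /-- continue at instruction `l` if `reg a < reg b`, and at the next instruction otherwise -/
  | jumpLT (a b l : ℕ)
  /-- stop with answer yes (`true`) or no (`false`) -/
  | halt (answer : Bool)

/-- A program is a finite list of instructions. -/
abbrev Program : Type := List Instr

/-- A configuration: program counter, registers and memory. -/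
structure Config : Type where
  pc : ℕ
  reg : ℕ → ℕ
  mem : ℕ → ℕ

/-- The effect of a single instruction. -/
def Instr.exec (i : Instr) (s : Config) : Config :=
  match i with
  | .const d k => ⟨s.pc + 1, Function.update s.reg d k, s.mem⟩
  | .add d a b => ⟨s.pc + 1, Function.update s.reg d (s.reg a + s.reg b), s.mem⟩
  | .sub d a b => ⟨s.pc + 1, Function.update s.reg d (s.reg a - s.reg b), s.mem⟩
  | .load d a => ⟨s.pc + 1, Function.update s.reg d (s.mem (s.reg a)), s.mem⟩
  | .store a k => ⟨s.pc + 1, s.reg, Function.update s.mem (s.reg a) (s.reg k)⟩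
  | .jump l => ⟨l, s.reg, s.mem⟩
  | .jumpLT a b l => ⟨if s.reg a < s.reg b then l else s.pc + 1, s.reg, s.mem⟩
  | .halt _ => s

/-- One step of the machine. If the program counter points outside the program, the machine is
stuck: it stays in the same configuration, without ever giving an answer. -/
def step (P : Program) (s : Config) : Config :=
  match P[s.pc]? with
  | some i => i.exec s
  | none => s

/-- The initial configuration: the input is written at the beginning of the memory, everything else
is `0`. -/
def init (input : List ℕ) : Config :=
  ⟨0, fun _ => 0, fun i => input.getD i 0⟩

/-- The configuration after `k` steps on the given input. -/
def run (P : Program) (input : List ℕ) (k : ℕ) : Config :=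
  (step P)^[k] (init input)

/-- On the given input, `P` has reached a halting instruction with answer `b` after at most `k`
steps. -/
def AnswersWithin (P : Program) (input : List ℕ) (k : ℕ) (b : Bool) : Prop :=
  ∃ j ≤ k, P[(run P input j).pc]? = some (Instr.halt b)

/-- Throughout the computation of `P` on the given input, all numbers in registers and in memory
are at most `B`. -/
def WordsBounded (P : Program) (input : List ℕ) (B : ℕ) : Prop :=
  ∀ k i : ℕ, (run P input k).reg i ≤ B ∧ (run P input k).mem i ≤ B

end RAM

/-! ### Adjacency lists -/

/-- `L` lists, for every vertex of `G`, its neighbours, each exactly once and in any order. -/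
def SimpleGraph.IsAdjList {n : ℕ} (G : SimpleGraph (Fin n)) (L : Fin n → List (Fin n)) : Prop :=
  ∀ v : Fin n, (L v).Nodup ∧ ∀ w : Fin n, w ∈ L v ↔ G.Adj v w

/-- The adjacency lists as a sequence of numbers: first `n`, then a table of `n + 1` addresses, then
the lists of the vertices `0, …, n - 1` one after the other. The list of the vertex `v` occupies the
addresses from `table v` up to, but not including, `table (v + 1)`. -/
def adjListInput {n : ℕ} (L : Fin n → List (Fin n)) : List ℕ :=
  [n] ++
    (List.range (n + 1)).map
      (fun k => n + 2 + ∑ v : Fin n, if (v : ℕ) < k then (L v).length else 0) ++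
    (List.ofFn fun v : Fin n => (L v).map fun w : Fin n => (w : ℕ)).flatten

/-!
Call a vertex `w` pendant if it has a single neighbour and this neighbour has another one, and call
`c` a hub if it is adjacent to all vertices but itself and some pendant ones. A `P₄`-tidy graph is
`2`-admissible if and only if it has a hub. Indeed, in a tree `2`-spanner `T`, tidiness applied to
the induced paths of `G` on long paths of `T` shows that vertices which are not pendant have
distance at most `4` in `T`, so that a vertex in the middle of them all is a hub. Conversely,
deleting from `G` the edges between neighbours of a hub leaves a tree `2`-spanner.

A hub is found in linear time without computing any set of neighbours: whether a vertex is pendant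
can be read off from two degrees, and `c` is a hub if and only if its closed neighbourhood contains
as many vertices that are not pendant as the whole graph.
-/

namespace TwoAdmissibility

open SimpleGraph

variable {V : Type*} {G T : SimpleGraph V}

/-! ### Ends of induced paths in a `P₄`-tidy graph -/

/-- The vertices `a, b, c, d` induce a path of `G`, in this order. -/
structure InducedP4 (G : SimpleGraph V) (a b c d : V) : Prop where
  ab : G.Adj a b
  bc : G.Adj b c
  cd : G.Adj c d
  ac : ¬G.Adj a c
  ad : ¬G.Adj a d
  bd : ¬G.Adj b d

namespace InducedP4

variable {a b c d : V}

theorem symm (h : InducedP4 G a b c d) : InducedP4 G d c b a where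
  ab := h.cd.symm
  bc := h.bc.symm
  cd := h.ab.symm
  ac := fun h' => h.bd h'.symm
  ad := fun h' => h.ad h'.symm
  bd := fun h' => h.ac h'.symm

theorem adj_iff (h : InducedP4 G a b c d) (i j : Fin 4) :
    G.Adj (![a, b, c, d] i) (![a, b, c, d] j) ↔ (pathGraph 4).Adj i j := by
  have := h.symm
  fin_cases i <;> fin_cases j <;>
    simp [pathGraph_adj, h.ab, h.bc, h.cd, h.ac, h.ad, h.bd, this.ab, this.bc, this.cd, this.ac,
      this.ad, this.bd]

theorem injective (h : InducedP4 G a b c d) : Function.Injective ![a, b, c, d] := by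
  have hac : a ≠ c := fun e => h.ad (e ▸ h.cd)
  have had : a ≠ d := fun e => h.bd (e ▸ h.ab.symm)
  have hbd : b ≠ d := fun e => h.ad (e ▸ h.ab)
  intro i j hij
  fin_cases i <;> fin_cases j <;>
    simp_all [h.ab.ne, h.bc.ne, h.cd.ne, h.ab.ne', h.bc.ne', h.cd.ne', eq_comm]

theorem inducesP4 [DecidableEq V] (h : InducedP4 G a b c d) : G.InducesP4 {a, b, c, d} := by
  let f : pathGraph 4 ↪g G := ⟨⟨![a, b, c, d], h.injective⟩, h.adj_iff _ _⟩
  have hrange : Set.range f = (({a, b, c, d} : Finset V) : Set V) := by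
    change Set.range ![a, b, c, d] = _
    ext x
    simp [eq_comm, or_comm, or_left_comm]
  rw [InducesP4, ← hrange]
  exact ⟨f.isoInduceRange.symm⟩

end InducedP4

theorem two_le_numP4 {U P Q : Finset V} (hP : P ⊆ U) (hQ : Q ⊆ U) (hGP : G.InducesP4 P)
    (hGQ : G.InducesP4 Q) (hPQ : P ≠ Q) : 2 ≤ G.numP4 U := by
  have hfin : {W : Finset V | W ⊆ U ∧ G.InducesP4 W}.Finite :=
    U.powerset.finite_toSet.subset fun W hW => by simpa using hW.1
  exact (Set.one_lt_ncard hfin).2 ⟨P, ⟨hP, hGP⟩, Q, ⟨hQ, hGQ⟩, hPQ⟩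

theorem InducedP4.two_le_numP4_insert [DecidableEq V] {a b c d v : V} (h : InducedP4 G a b c d)
    (hva : G.Adj v a) (hvb : v ≠ b) (hvd : ¬G.Adj v d) :
    v ∉ ({a, b, c, d} : Finset V) ∧ 2 ≤ G.numP4 (insert v {a, b, c, d}) := by
  have hv : v ∉ ({a, b, c, d} : Finset V) := by
    simp only [Finset.mem_insert, Finset.mem_singleton]
    rintro (rfl | rfl | rfl | rfl)
    exacts [hva.ne rfl, hvb rfl, h.ac hva.symm, h.ad hva.symm]
  have second_path {Q : Finset V} (hGQ : G.InducesP4 Q) (hvQ : v ∈ Q)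
      (hQ : Q ⊆ insert v {a, b, c, d}) : 2 ≤ G.numP4 (insert v {a, b, c, d}) :=
    two_le_numP4 (Finset.subset_insert _ _) hQ h.inducesP4 hGQ (by rintro rfl; exact hv hvQ)
  refine ⟨hv, ?_⟩
  by_cases hvc : G.Adj v c
  · exact second_path (InducedP4.inducesP4 ⟨hva.symm, hvc, h.cd, h.ac, h.ad, hvd⟩) (by simp)
      (by grind)
  by_cases hvb : G.Adj v b
  · exact second_path (InducedP4.inducesP4 ⟨hvb, h.bc, h.cd, hvc, hvd, h.bd⟩) (by simp) (by grind)
  · exact second_path (InducedP4.inducesP4 ⟨hva, h.ab, h.bc, hvb, hvc, h.ac⟩) (by simp) (by grind)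

theorem InducedP4.neighborSet_diff_subset_or [DecidableEq V] {a b c d : V}
    (h : InducedP4 G a b c d) (hG : G.IsP4Tidy) :
    G.neighborSet a \ {b} ⊆ G.neighborSet d ∨ G.neighborSet d \ {c} ⊆ G.neighborSet a := by
  by_contra! ⟨ha, hd⟩
  obtain ⟨x, ⟨hax, hxb⟩, hdx⟩ := Set.not_subset.1 ha
  obtain ⟨y, ⟨hdy, hyc⟩, hay⟩ := Set.not_subset.1 hd
  obtain ⟨hx, hx2⟩ := h.two_le_numP4_insert hax.symm hxb fun h' => hdx h'.symm
  obtain ⟨hy, hy2⟩ := h.symm.two_le_numP4_insert hdy.symm hyc fun h' => hay h'.symm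
  have hset : ({d, c, b, a} : Finset V) = {a, b, c, d} := by grind
  rw [hset] at hy hy2
  obtain rfl := hG _ h.inducesP4 x y hx hy hx2 hy2
  exact hay hax

/-! ### Geodesics of a tree -/

/-- `p 0, p 1, …, p k` is a shortest path of `T`. -/
structure IsGeodesic (T : SimpleGraph V) (p : ℕ → V) (k : ℕ) : Prop where
  adj : ∀ i < k, T.Adj (p i) (p (i + 1))
  dist_ends : T.dist (p 0) (p k) = k

theorem isGeodesic_getVert {u v : V} (w : T.Walk u v) (hw : w.length = T.dist u v) :
    IsGeodesic T w.getVert w.length where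
  adj _ hi := w.adj_getVert_succ hi
  dist_ends := by rw [w.getVert_zero, w.getVert_length, hw]

theorem exists_isGeodesic (hT : T.Connected) (u v : V) :
    ∃ p, IsGeodesic T p (T.dist u v) ∧ p 0 = u ∧ p (T.dist u v) = v := by
  obtain ⟨w, hw⟩ := hT.exists_walk_length_eq_dist u v
  exact ⟨w.getVert, hw ▸ isGeodesic_getVert w hw, w.getVert_zero, hw ▸ w.getVert_length⟩

theorem exists_isGeodesic_through (hT : T.Connected) {u v w : V}
    (h : T.dist u v + T.dist v w = T.dist u w) :
    ∃ p, IsGeodesic T p (T.dist u w) ∧ p 0 = u ∧ p (T.dist u v) = v ∧ p (T.dist u w) = w := by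
  obtain ⟨q, hq⟩ := hT.exists_walk_length_eq_dist u v
  obtain ⟨r, hr⟩ := hT.exists_walk_length_eq_dist v w
  have hqr : (q.append r).length = T.dist u w := by rw [Walk.length_append, hq, hr, h]
  refine ⟨(q.append r).getVert, hqr ▸ isGeodesic_getVert _ hqr, Walk.getVert_zero _, ?_,
    hqr ▸ Walk.getVert_length _⟩
  rw [Walk.getVert_append, ← hq, if_neg (lt_irrefl _), Nat.sub_self, Walk.getVert_zero]

namespace IsGeodesic

variable {p : ℕ → V} {k : ℕ}

theorem dist_eq (h : IsGeodesic T p k) (hT : T.Connected) {i j : ℕ} (hij : i ≤ j) (hjk : j ≤ k) :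
    T.dist (p i) (p j) = j - i := by
  have dist_le {i j : ℕ} (hij : i ≤ j) (hjk : j ≤ k) : T.dist (p i) (p j) ≤ j - i := by
    induction j, hij using Nat.le_induction with
    | base => simp
    | succ j hij ih =>
      have hstep := dist_eq_one_iff_adj.2 (h.adj j hjk)
      have := hT.dist_triangle (u := p i) (v := p j) (w := p (j + 1))
      have := ih (by lia)
      lia
  have h0 := dist_le (Nat.zero_le i) (hij.trans hjk)
  have hij' := dist_le hij hjk
  have hk := dist_le hjk le_rfl
  have := hT.dist_triangle (u := p 0) (v := p i) (w := p k)
  have := hT.dist_triangle (u := p i) (v := p j) (w := p k)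
  have := h.dist_ends
  lia

theorem shift (h : IsGeodesic T p k) (hT : T.Connected) {i m : ℕ} (him : i + m ≤ k) :
    IsGeodesic T (fun j => p (i + j)) m where
  adj j hj := h.adj (i + j) (by lia)
  dist_ends := by rw [h.dist_eq hT (by lia) him]; lia

theorem reverse (h : IsGeodesic T p k) : IsGeodesic T (fun j => p (k - j)) k where
  adj j hj := by
    have := (h.adj (k - (j + 1)) (by lia)).symm
    rwa [show k - (j + 1) + 1 = k - j by lia] at this
  dist_ends := by rw [Nat.sub_self, Nat.sub_zero, dist_comm, h.dist_ends]

theorem ne (h : IsGeodesic T p k) (hT : T.Connected) {i j : ℕ} (hij : i < j) (hjk : j ≤ k) :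
    p i ≠ p j := by
  intro e
  have := h.dist_eq hT hij.le hjk
  rw [e, dist_self] at this
  lia

end IsGeodesic

theorem dist_eq_add_one_of_adj_of_ne (hT : T.IsTree) {z a b x : V} (hab : T.Adj a b)
    (hz : T.dist z a = T.dist z b + 1) (hax : T.Adj a x) (hxb : x ≠ b) :
    T.dist z x = T.dist z a + 1 := by
  refine (hT.dist_eq_dist_add_one_of_adj z hax).resolve_left fun hzx => hxb ?_
  have exists_path {y : V} (hay : T.Adj a y) (hzy : T.dist z a = T.dist z y + 1) :
      ∃ q : T.Path a z, q.1.snd = y := by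
    obtain ⟨q, hq⟩ := hT.connected.exists_walk_length_eq_dist y z
    refine ⟨⟨.cons hay q, Walk.isPath_of_length_eq_dist _ ?_⟩, by simp⟩
    rw [Walk.length_cons, hq, dist_comm, ← hzy, dist_comm]
  obtain ⟨q, rfl⟩ := exists_path hab hz
  obtain ⟨r, rfl⟩ := exists_path hax hzx
  rw [(hT.isAcyclic.subsingleton_path a z).elim q r]

theorem IsGeodesic.dist_eq_add (hT : T.IsTree) {p : ℕ → V} {k : ℕ} (h : IsGeodesic T p k) {z : V}
    (hz : T.dist z (p 1) = T.dist z (p 0) + 1) {j : ℕ} (hj : j ≤ k) :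
    T.dist z (p j) = T.dist z (p 0) + j := by
  induction j using Nat.strong_induction_on with
  | _ j ih =>
    match j with
    | 0 => rfl
    | 1 => exact hz
    | j + 2 =>
      have hj0 := ih j (by lia) (by lia)
      have hj1 := ih (j + 1) (by lia) (by lia)
      rw [dist_eq_add_one_of_adj_of_ne hT (h.adj j (by lia)).symm (by lia) (h.adj (j + 1) hj)
        (h.ne hT.connected (by lia) hj).symm, hj1]
      rfl

theorem IsGeodesic.dist_eq_add_or (hT : T.IsTree) {p : ℕ → V} {k : ℕ} (h : IsGeodesic T p k)
    (z : V) {i : ℕ} (hi : i ≤ k) :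
    T.dist z (p 0) = T.dist z (p i) + i ∨ T.dist z (p k) = T.dist z (p i) + (k - i) := by
  obtain rfl | hik := hi.eq_or_lt
  · simp
  obtain rfl | hi0 := i.eq_zero_or_pos
  · simp
  have hfwd : T.Adj (p i) (p (i + 1)) := h.adj i hik
  have hbwd : T.Adj (p i) (p (i - 1)) := by
    simpa [Nat.sub_add_cancel hi0] using (h.adj (i - 1) (by lia)).symm
  obtain hz | hz := hT.dist_eq_dist_add_one_of_adj z hfwd
  · left
    have hne : p (i - 1) ≠ p (i + 1) := h.ne hT.connected (by lia) hik
    have := ((h.shift hT.connected (i := 0) (m := i) (by lia)).reverse).dist_eq_add hT (z := z)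
      (by simpa using dist_eq_add_one_of_adj_of_ne hT hfwd hz hbwd hne) le_rfl
    simpa using this
  · right
    have := (h.shift hT.connected (i := i) (m := k - i) (by lia)).dist_eq_add hT (z := z)
      (by simpa using hz) le_rfl
    simpa [Nat.add_sub_cancel' hi] using this

/-! ### Hubs -/

/-- `w` is a pendant vertex of `G`, and its edge is not a connected component of `G`. -/
def IsPendant (G : SimpleGraph V) (w : V) : Prop :=
  ∃ p, (∀ q, G.Adj w q ↔ q = p) ∧ ∃ q, q ≠ w ∧ G.Adj p q

/-- `c` is adjacent to all vertices but itself and some pendant ones. In a `P₄`-tidy graph, the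
existence of such a vertex decides `2`-admissibility. -/
def IsHub (G : SimpleGraph V) (c : V) : Prop :=
  ∀ w, w ≠ c → ¬G.Adj c w → IsPendant G w

theorem not_isPendant_of_adj_of_adj {w x y : V} (hx : G.Adj w x) (hy : G.Adj w y) (hxy : x ≠ y) :
    ¬IsPendant G w := by
  rintro ⟨p, hp, -⟩
  exact hxy (((hp x).1 hx).trans ((hp y).1 hy).symm)

theorem exists_adj_ne_of_not_isPendant {w p q : V} (hw : ¬IsPendant G w) (hwp : G.Adj w p)
    (hpq : G.Adj p q) (hq : q ≠ w) : ∃ x, G.Adj w x ∧ x ≠ p := by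
  contrapose! hw
  exact ⟨p, fun x => ⟨hw x, fun h => h ▸ hwp⟩, q, hq, hpq⟩

theorem isHub_of_dist_le_one (hT : T.Connected) (hle : T ≤ G) {c : V}
    (h : ∀ w, ¬IsPendant G w → T.dist w c ≤ 1) : IsHub G c := by
  intro w hwc hcw
  by_contra hw
  have := hT.one_lt_dist_of_ne_of_not_adj hwc fun h' => hcw (hle h').symm
  exact this.not_ge (h w hw)

/-! ### Tree `2`-spanners of a `P₄`-tidy graph -/

theorem dist_le_of_isTreeSpanner_of_adj {t : ℕ} (hT : G.IsTreeSpanner T t) {u v : V}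
    (h : G.Adj u v) : T.dist u v ≤ t := by
  simpa [dist_eq_one_iff_adj.2 h] using hT.2.2 u v

theorem not_adj_of_two_lt_dist (hT : G.IsTreeSpanner T 2) {u v : V} (h : 2 < T.dist u v) :
    ¬G.Adj u v :=
  fun h' => h.not_ge (dist_le_of_isTreeSpanner_of_adj hT h')

variable {p : ℕ → V} {k : ℕ}

theorem IsGeodesic.not_isPendant (hT : G.IsTreeSpanner T 2) (h : IsGeodesic T p k) {i : ℕ}
    (hi : 0 < i) (hik : i < k) : ¬IsPendant G (p i) := by
  obtain ⟨i, rfl⟩ := Nat.exists_eq_succ_of_ne_zero hi.ne'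
  exact not_isPendant_of_adj_of_adj (hT.1 (h.adj i (by lia)).symm) (hT.1 (h.adj (i + 1) hik))
    (h.ne hT.2.1.connected (by lia) hik)

/-- A neighbour `x` of the end of a geodesic, other than the two vertices preceding that end, is
reached in `T` from the last two vertices of the geodesic without backtracking. -/
theorem IsGeodesic.two_lt_dist_of_adj (hT : G.IsTreeSpanner T 2) (h : IsGeodesic T p (k + 3))
    {x : V} (hx : G.Adj (p (k + 3)) x) (hx2 : x ≠ p (k + 2)) (hx1 : x ≠ p (k + 1)) :
    2 < T.dist (p 0) x := by
  have hC := hT.2.1.connected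
  have h1 : T.dist (p 0) (p (k + 1)) = k + 1 := h.dist_eq hC (by lia) (by lia)
  have h2 : T.dist (p 0) (p (k + 2)) = k + 2 := h.dist_eq hC (by lia) (by lia)
  have h3 : T.dist (p 0) (p (k + 3)) = k + 3 := h.dist_ends
  have hadj : T.Adj (p (k + 3)) (p (k + 2)) := (h.adj (k + 2) (by lia)).symm
  obtain ⟨y, hy, hyx⟩ : ∃ y, (y = p (k + 3) ∨ T.Adj (p (k + 3)) y) ∧ T.Adj y x := by
    obtain ⟨q, hq, hq0, hqx⟩ := exists_isGeodesic hC (p (k + 3)) x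
    have hle := dist_le_of_isTreeSpanner_of_adj hT hx
    have hpos := hC.pos_dist_of_ne hx.ne
    obtain hd | hd : T.dist (p (k + 3)) x = 1 ∨ T.dist (p (k + 3)) x = 2 := by lia
    · exact ⟨_, .inl rfl, dist_eq_one_iff_adj.1 hd⟩
    · rw [hd] at hq hqx
      exact ⟨q 1, .inr (hq0 ▸ hq.adj 0 two_pos), hqx ▸ hq.adj 1 one_lt_two⟩
  obtain rfl | hy := hy
  · rw [dist_eq_add_one_of_adj_of_ne hT.2.1 hadj (by lia) hyx hx2]
    lia
  by_cases hy2 : y = p (k + 2)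
  · subst hy2
    rw [dist_eq_add_one_of_adj_of_ne hT.2.1 (h.adj (k + 1) (by lia)).symm (by lia) hyx hx1]
    lia
  · have hyd := dist_eq_add_one_of_adj_of_ne hT.2.1 hadj (by rw [h3, h2]) hy hy2
    rw [dist_eq_add_one_of_adj_of_ne hT.2.1 hy.symm hyd hyx hx.ne']
    lia

theorem InducedP4.not_two_lt_dist_of_adj [DecidableEq V] (hG : G.IsP4Tidy)
    (hT : G.IsTreeSpanner T 2) {a b c d a' d' : V} (h : InducedP4 G a b c d)
    (ha : G.Adj a a') (ha' : a' ≠ b) (hd : G.Adj d d') (hd' : d' ≠ c) :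
    ¬(2 < T.dist d a' ∧ 2 < T.dist a d') := by
  rintro ⟨hda', had'⟩
  obtain hsub | hsub := h.neighborSet_diff_subset_or hG
  · exact not_adj_of_two_lt_dist hT hda' (hsub ⟨ha, ha'⟩)
  · exact not_adj_of_two_lt_dist hT had' (hsub ⟨hd, hd'⟩)

theorem IsGeodesic.not_adj (hT : G.IsTreeSpanner T 2) (h : IsGeodesic T p k) {i j : ℕ}
    (hij : i + 3 ≤ j) (hj : j ≤ k) : ¬G.Adj (p i) (p j) := by
  refine not_adj_of_two_lt_dist hT ?_
  rw [h.dist_eq hT.2.1.connected (by lia) hj]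
  lia

theorem IsGeodesic.exists_adj_ne (hT : G.IsTreeSpanner T 2) (h : IsGeodesic T p (k + 2))
    (h0 : ¬IsPendant G (p 0)) : ∃ x, G.Adj (p 0) x ∧ x ≠ p 1 :=
  exists_adj_ne_of_not_isPendant h0 (hT.1 (h.adj 0 (by lia))) (hT.1 (h.adj 1 (by lia)))
    (h.ne hT.2.1.connected two_pos (by lia)).symm

theorem IsGeodesic.adj_or_adj_of_three [DecidableEq V] (hG : G.IsP4Tidy)
    (hT : G.IsTreeSpanner T 2) (h : IsGeodesic T p 3) (h0 : ¬IsPendant G (p 0))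
    (h3 : ¬IsPendant G (p 3)) : G.Adj (p 0) (p 2) ∨ G.Adj (p 1) (p 3) := by
  by_contra! ⟨h02, h13⟩
  have hadj (i : ℕ) (hi : i < 3) : G.Adj (p i) (p (i + 1)) := hT.1 (h.adj i hi)
  have hP : InducedP4 G (p 0) (p 1) (p 2) (p 3) :=
    ⟨hadj 0 (by lia), hadj 1 (by lia), hadj 2 (by lia), h02, h.not_adj hT le_rfl le_rfl, h13⟩
  obtain ⟨x, hx, hx1⟩ := h.exists_adj_ne (k := 1) hT h0
  obtain ⟨y, hy, hy2⟩ := h.reverse.exists_adj_ne (k := 1) hT h3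
  refine hP.not_two_lt_dist_of_adj hG hT hx hx1 hy hy2 ⟨?_, ?_⟩
  · exact h.reverse.two_lt_dist_of_adj (k := 0) hT hx hx1 fun e => h02 (e ▸ hx)
  · exact h.two_lt_dist_of_adj (k := 0) hT hy hy2 fun e => h13 (e ▸ hy).symm

theorem IsGeodesic.adj_of_four [DecidableEq V] (hG : G.IsP4Tidy) (hT : G.IsTreeSpanner T 2)
    (h : IsGeodesic T p 4) (h0 : ¬IsPendant G (p 0)) (h4 : ¬IsPendant G (p 4)) :
    G.Adj (p 2) (p 4) := by
  by_contra h24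
  have hC := hT.2.1.connected
  have hadj (i : ℕ) (hi : i < 4) : G.Adj (p i) (p (i + 1)) := hT.1 (h.adj i hi)
  have h04 := h.not_adj hT (i := 0) (j := 4) (by lia) le_rfl
  have h03 := h.not_adj hT (i := 0) (j := 3) (by lia) (by lia)
  have h14 := h.not_adj hT (i := 1) (j := 4) (by lia) (by lia)
  obtain ⟨y, hy, hy3⟩ := h.reverse.exists_adj_ne (k := 2) hT h4
  have hdy : 2 < T.dist (p 0) y :=
    h.two_lt_dist_of_adj (k := 1) hT hy hy3 fun e => h24 (e ▸ hy).symm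
  by_cases h02 : G.Adj (p 0) (p 2)
  · have hP : InducedP4 G (p 0) (p 2) (p 3) (p 4) :=
      ⟨h02, hadj 2 (by lia), hadj 3 (by lia), h03, h04, h24⟩
    refine hP.not_two_lt_dist_of_adj hG hT (hadj 0 (by lia)) (h.ne hC (by lia) (by lia)) hy hy3
      ⟨?_, hdy⟩
    rw [dist_comm, h.dist_eq hC (by lia) le_rfl]
    lia
  · have h13 : G.Adj (p 1) (p 3) := by
      have hs := h.shift hC (i := 1) (m := 3) le_rfl
      exact (hs.adj_or_adj_of_three hG hT
        (h.not_isPendant hT one_pos (by lia)) h4).resolve_right h24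
    have hP : InducedP4 G (p 0) (p 1) (p 3) (p 4) :=
      ⟨hadj 0 (by lia), h13, hadj 3 (by lia), h03, h04, h14⟩
    obtain ⟨x, hx, hx1⟩ := h.exists_adj_ne (k := 2) hT h0
    refine hP.not_two_lt_dist_of_adj hG hT hx hx1 hy hy3 ⟨?_, hdy⟩
    exact h.reverse.two_lt_dist_of_adj (k := 1) hT hx hx1 fun e => h02 (e ▸ hx)

theorem not_isGeodesic_five [DecidableEq V] (hG : G.IsP4Tidy) (hT : G.IsTreeSpanner T 2)
    (h0 : ¬IsPendant G (p 0)) (h5 : ¬IsPendant G (p 5)) : ¬IsGeodesic T p 5 := by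
  intro h
  have hC := hT.2.1.connected
  have hadj (i : ℕ) (hi : i < 5) : G.Adj (p i) (p (i + 1)) := hT.1 (h.adj i hi)
  have h02 : G.Adj (p 0) (p 2) :=
    ((h.shift hC (i := 0) (m := 4) (by lia)).reverse.adj_of_four hG hT
      (h.not_isPendant hT (i := 0 + 4) (by lia) (by lia)) h0).symm
  have h35 : G.Adj (p 3) (p 5) :=
    (h.shift hC (i := 1) (m := 4) le_rfl).adj_of_four hG hT
      (h.not_isPendant hT (i := 1) (by lia) (by lia)) h5
  have hP : InducedP4 G (p 0) (p 2) (p 3) (p 5) :=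
    ⟨h02, hadj 2 (by lia), h35, h.not_adj hT le_rfl (by lia), h.not_adj hT (by lia) le_rfl,
      h.not_adj hT le_rfl le_rfl⟩
  refine hP.not_two_lt_dist_of_adj hG hT (hadj 0 (by lia)) (h.ne hC (by lia) (by lia))
    (hadj 4 (by lia)).symm (h.ne hC (by lia) (by lia)).symm ⟨?_, ?_⟩
  · rw [dist_comm, h.dist_eq hC (by lia) le_rfl]
    lia
  · rw [h.dist_eq hC (by lia) (by lia)]
    lia

theorem dist_le_four_of_not_isPendant [DecidableEq V] (hG : G.IsP4Tidy)
    (hT : G.IsTreeSpanner T 2) {u v : V} (hu : ¬IsPendant G u) (hv : ¬IsPendant G v) :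
    T.dist u v ≤ 4 := by
  by_contra! hlt
  obtain ⟨p, hp, hp0, hpv⟩ := exists_isGeodesic hT.2.1.connected u v
  have hp5 : ¬IsPendant G (p 5) := by
    obtain h5 | h5 : T.dist u v = 5 ∨ 5 < T.dist u v := by lia
    · rwa [← h5, hpv]
    · exact hp.not_isPendant hT (by lia) h5
  refine not_isGeodesic_five hG hT (hp0 ▸ hu) hp5 ?_
  simpa using hp.shift hT.2.1.connected (i := 0) hlt

/-! ### A tree `2`-spanner of a `P₄`-tidy graph yields a hub -/

theorem adj_of_dist_eq_dist_add_two [DecidableEq V] (hG : G.IsP4Tidy) (hT : G.IsTreeSpanner T 2)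
    {u c w : V} (hu : ¬IsPendant G u) (hw : ¬IsPendant G w) (huc : T.dist u c = 2) (hcw : c ≠ w)
    (huw : T.dist w u = T.dist w c + 2) : G.Adj c w := by
  have hC := hT.2.1.connected
  have hle := dist_le_four_of_not_isPendant hG hT hw hu
  have hpos := hC.pos_dist_of_ne hcw.symm
  obtain hd | hd : T.dist w c = 1 ∨ T.dist w c = 2 := by lia
  · exact hT.1 (dist_eq_one_iff_adj.1 hd).symm
  · have huw4 : T.dist u w = 4 := by rw [dist_comm, huw, hd]
    obtain ⟨q, hq, hq0, hq2, hq4⟩ := exists_isGeodesic_through hC (u := u) (v := c) (w := w)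
      (by rw [dist_comm (u := c), huc, hd, huw4])
    rw [huc] at hq2
    rw [huw4] at hq hq4
    exact hq2 ▸ hq4 ▸ hq.adj_of_four hG hT (hq0 ▸ hu) (hq4 ▸ hw)

theorem IsGeodesic.isHub_of_four [DecidableEq V] (hG : G.IsP4Tidy) (hT : G.IsTreeSpanner T 2)
    (h : IsGeodesic T p 4) (h0 : ¬IsPendant G (p 0)) (h4 : ¬IsPendant G (p 4)) :
    IsHub G (p 2) := by
  have hC := hT.2.1.connected
  intro w hwc hcw
  by_contra hw
  refine hcw ?_
  obtain hd | hd := h.dist_eq_add_or hT.2.1 w (i := 2) (by lia)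
  · exact adj_of_dist_eq_dist_add_two hG hT h0 hw (h.dist_eq hC (by lia) (by lia)) hwc.symm hd
  · refine adj_of_dist_eq_dist_add_two hG hT h4 hw ?_ hwc.symm hd
    rw [dist_comm, h.dist_eq hC (by lia) le_rfl]

theorem IsGeodesic.dist_le_one_or (hT : T.IsTree) (h : IsGeodesic T p 3) {w : V}
    (h0 : T.dist w (p 0) ≤ 3) (h3 : T.dist w (p 3) ≤ 3) :
    T.dist w (p 1) ≤ 1 ∨ T.dist w (p 2) ≤ 1 := by
  have := h.dist_eq_add_or hT w (i := 1) (by lia)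
  have := h.dist_eq_add_or hT w (i := 2) (by lia)
  have := hT.dist_eq_dist_add_one_of_adj w (h.adj 1 (by lia))
  lia

theorem adj_or_adj_of_dist_eq_three [DecidableEq V] (hG : G.IsP4Tidy)
    (hT : G.IsTreeSpanner T 2) {a b c d : V} (hab : T.Adj a b) (hbc : T.Adj b c) (hcd : T.Adj c d)
    (had : T.dist a d = 3) (ha : ¬IsPendant G a) (hd : ¬IsPendant G d) :
    G.Adj a c ∨ G.Adj b d :=
  (isGeodesic_getVert (.cons hab (.cons hbc (.cons hcd .nil))) had.symm).adj_or_adj_of_three hG hT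
    ha hd

theorem IsGeodesic.exists_isHub_of_three [DecidableEq V] (hG : G.IsP4Tidy)
    (hT : G.IsTreeSpanner T 2) (h : IsGeodesic T p 3) (h0 : ¬IsPendant G (p 0))
    (h3 : ¬IsPendant G (p 3))
    (hle : ∀ u v, ¬IsPendant G u → ¬IsPendant G v → T.dist u v ≤ 3) : ∃ c, IsHub G c := by
  have hC := hT.2.1.connected
  have hbc : T.Adj (p 1) (p 2) := h.adj 1 (by lia)
  have eq_or_adj {w c : V} (hw : T.dist w c ≤ 1) : w = c ∨ T.Adj w c := by
    obtain hd | hd := Nat.le_one_iff_eq_zero_or_eq_one.1 hw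
    · exact .inl (hC.dist_eq_zero_iff.1 hd)
    · exact .inr (dist_eq_one_iff_adj.1 hd)
  have near {w : V} (hw : ¬IsPendant G w) :=
    h.dist_le_one_or hT.2.1 (hle w _ hw h0) (hle w _ hw h3)
  by_cases hc : IsHub G (p 2)
  · exact ⟨_, hc⟩
  refine ⟨p 1, ?_⟩
  obtain ⟨w, hwc, hcw, hw⟩ : ∃ w, w ≠ p 2 ∧ ¬G.Adj (p 2) w ∧ ¬IsPendant G w := by
    simpa only [IsHub, not_forall, exists_prop] using hc
  have hwb : T.Adj w (p 1) := by
    obtain hd | hd := near hw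
    · exact (eq_or_adj hd).resolve_left fun e => hcw (e ▸ hT.1 hbc.symm)
    · exact absurd (hT.1 ((eq_or_adj hd).resolve_left hwc).symm) hcw
  intro v hvb hbv
  by_contra hv
  have hvc : T.Adj v (p 2) := by
    obtain hd | hd := near hv
    · exact absurd (hT.1 ((eq_or_adj hd).resolve_left hvb).symm) hbv
    · exact (eq_or_adj hd).resolve_left fun e => hbv (e ▸ hT.1 hbc)
  have hdc : T.dist w (p 2) = 2 := by
    rw [dist_eq_add_one_of_adj_of_ne hT.2.1 hwb.symm (by simpa using hwb) hbc hwc.symm,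
      dist_eq_one_iff_adj.2 hwb]
  have hdv : T.dist w v = 3 := by
    rw [dist_eq_add_one_of_adj_of_ne hT.2.1 hbc.symm (by simpa [hdc] using hwb) hvc.symm hvb, hdc]
  exact (adj_or_adj_of_dist_eq_three hG hT hwb hbc hvc.symm hdv hw hv).elim
    (fun e => hcw e.symm) hbv

theorem IsGeodesic.isHub_of_two (hT : G.IsTreeSpanner T 2) (h : IsGeodesic T p 2)
    (h0 : ¬IsPendant G (p 0)) (h2 : ¬IsPendant G (p 2))
    (hle : ∀ u v, ¬IsPendant G u → ¬IsPendant G v → T.dist u v ≤ 2) : IsHub G (p 1) := by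
  refine isHub_of_dist_le_one hT.2.1.connected hT.1 fun w hw => ?_
  have := h.dist_eq_add_or hT.2.1 w (i := 1) one_le_two
  have := hle w _ hw h0
  have := hle w _ hw h2
  lia

theorem exists_isHub_of_dist_le_one (hT : T.Connected) (hle : T ≤ G)
    (h : ∀ u v, ¬IsPendant G u → ¬IsPendant G v → T.dist u v ≤ 1) : ∃ c, IsHub G c := by
  by_cases hc : ∃ c, ¬IsPendant G c
  · obtain ⟨c, hc⟩ := hc
    exact ⟨c, isHub_of_dist_le_one hT hle fun w hw => h w c hw hc⟩
  · push Not at hc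
    exact ⟨hT.nonempty.some, fun w _ _ => hc w⟩

theorem exists_isHub [DecidableEq V] (hG : G.IsP4Tidy) (hT : G.IsTreeSpanner T 2) :
    ∃ c, IsHub G c := by
  have hC := hT.2.1.connected
  have dist_le {k : ℕ} (hk : ∀ u v, ¬IsPendant G u → ¬IsPendant G v → T.dist u v ≤ k + 1)
      (hne : ¬∃ p, IsGeodesic T p (k + 1) ∧ ¬IsPendant G (p 0) ∧ ¬IsPendant G (p (k + 1))) :
      ∀ u v, ¬IsPendant G u → ¬IsPendant G v → T.dist u v ≤ k := by
    intro u v hu hv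
    refine (hk u v hu hv).eq_or_lt.elim (fun hd => absurd ?_ hne) Nat.le_of_lt_succ
    obtain ⟨p, hp, rfl, hpv⟩ := exists_isGeodesic hC u v
    rw [hd] at hp hpv
    exact ⟨p, hp, hu, hpv ▸ hv⟩
  have h4 u v (hu : ¬IsPendant G u) (hv : ¬IsPendant G v) :=
    dist_le_four_of_not_isPendant hG hT hu hv
  by_cases hp4 : ∃ p, IsGeodesic T p 4 ∧ ¬IsPendant G (p 0) ∧ ¬IsPendant G (p 4)
  · obtain ⟨p, hp, hp0, hp4⟩ := hp4
    exact ⟨_, hp.isHub_of_four hG hT hp0 hp4⟩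
  by_cases hp3 : ∃ p, IsGeodesic T p 3 ∧ ¬IsPendant G (p 0) ∧ ¬IsPendant G (p 3)
  · obtain ⟨p, hp, hp0, hp3⟩ := hp3
    exact hp.exists_isHub_of_three hG hT hp0 hp3 (dist_le h4 hp4)
  by_cases hp2 : ∃ p, IsGeodesic T p 2 ∧ ¬IsPendant G (p 0) ∧ ¬IsPendant G (p 2)
  · obtain ⟨p, hp, hp0, hp2⟩ := hp2
    exact ⟨_, hp.isHub_of_two hT hp0 hp2 (dist_le (dist_le h4 hp4) hp3)⟩
  · exact exists_isHub_of_dist_le_one hC hT.1 (dist_le (dist_le (dist_le h4 hp4) hp3) hp2)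

/-! ### A hub yields a tree `2`-spanner -/

theorem isTree_of_forall_adj [Finite V] {c : V} (hreach : ∀ v, T.Reachable c v) (parent : V → V)
    (hparent : ∀ u v, T.Adj u v → u ≠ c ∧ parent u = v ∨ v ≠ c ∧ parent v = u) : T.IsTree := by
  have hC : T.Connected :=
    { preconnected := fun u v => (hreach u).symm.trans (hreach v)
      nonempty := ⟨c⟩ }
  refine isTree_iff_connected_and_card.2 ⟨hC, le_antisymm ?_ hC.card_vert_le_card_edgeSet_add_one⟩
  have hsub : T.edgeSet ⊆ (fun v => s(v, parent v)) '' {c}ᶜ := by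
    intro e
    induction e with
    | _ u v =>
      intro huv
      obtain ⟨hu, rfl⟩ | ⟨hv, rfl⟩ := hparent u v huv
      · exact ⟨u, hu, rfl⟩
      · exact ⟨v, hv, Sym2.eq_swap⟩
  have hcard : T.edgeSet.ncard ≤ ({c}ᶜ : Set V).ncard :=
    (Set.ncard_le_ncard hsub (Set.toFinite _)).trans (Set.ncard_image_le (Set.toFinite _))
  have hcompl := Set.ncard_add_ncard_compl ({c} : Set V)
  rw [Set.ncard_singleton] at hcompl
  rw [Nat.card_coe_set_eq]
  lia

theorem isTreeSpanner_of_adj {t : ℕ} (hle : T ≤ G) (hT : T.IsTree)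
    (h : ∀ u v, G.Adj u v → T.dist u v ≤ t) : G.IsTreeSpanner T t := by
  refine ⟨hle, hT, fun u v => ?_⟩
  obtain ⟨q, hq⟩ := (hT.connected.mono hle).exists_walk_length_eq_dist u v
  rw [← hq]
  clear hq
  induction q with
  | nil => simp
  | cons hadj q ih =>
    refine hT.connected.dist_triangle.trans ((add_le_add (h _ _ hadj) ih).trans_eq ?_)
    rw [Walk.length_cons]
    ring

theorem IsHub.exists_adj_iff_eq {c w : V} (h : IsHub G c) (hwc : w ≠ c) (hcw : ¬G.Adj c w) :
    ∃ p, (∀ q, G.Adj w q ↔ q = p) ∧ G.Adj c p := by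
  obtain ⟨p, hp, x, hxw, hpx⟩ := h w hwc hcw
  have hwp : G.Adj w p := (hp p).2 rfl
  refine ⟨p, hp, by_contra fun hcp => ?_⟩
  have hpc : p ≠ c := fun e => hcw (e ▸ hwp.symm)
  exact not_isPendant_of_adj_of_adj hwp.symm hpx hxw.symm (h p hpc hcp)

/-- The edges of `G` that do not join two neighbours of `c`. If `c` is a hub, these form a tree
`2`-spanner. -/
def hubTree (G : SimpleGraph V) (c : V) : SimpleGraph V where
  Adj u v := G.Adj u v ∧ ¬(G.Adj c u ∧ G.Adj c v)
  symm := ⟨fun _ _ h => ⟨h.1.symm, fun h' => h.2 h'.symm⟩⟩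
  loopless := ⟨fun _ h => G.irrefl h.1⟩

theorem hubTree_adj_center {c v : V} (h : G.Adj c v) : (hubTree G c).Adj c v :=
  ⟨h, fun h' => G.irrefl h'.1⟩

theorem IsHub.isTree_hubTree [Finite V] {c : V} (h : IsHub G c) : (hubTree G c).IsTree := by
  classical
  choose! p hp hcp using fun w => h.exists_adj_iff_eq (w := w)
  refine isTree_of_forall_adj (c := c) (fun v => ?_) (fun v => if G.Adj c v then c else p v) ?_
  · by_cases hvc : v = c
    · exact hvc ▸ Reachable.refl _
    by_cases hcv : G.Adj c v
    · exact (hubTree_adj_center hcv).reachable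
    · have hpv : (hubTree G c).Adj (p v) v :=
        ⟨((hp v hvc hcv _).2 rfl).symm, fun h' => hcv h'.2⟩
      exact (hubTree_adj_center (hcp v hvc hcv)).reachable.trans hpv.reachable
  · rintro u v ⟨huv, hc⟩
    have of_not_adj {w x : V} (hwx : G.Adj w x) (hcw : ¬G.Adj c w) (hwc : w ≠ c) :
        w ≠ c ∧ (if G.Adj c w then c else p w) = x :=
      ⟨hwc, by rw [if_neg hcw, ← (hp w hwc hcw x).1 hwx]⟩
    have of_eq {w x : V} (hwx : G.Adj w x) (hxc : x = c) :
        w ≠ c ∧ (if G.Adj c w then c else p w) = x := by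
      subst hxc
      exact ⟨hwx.ne, if_pos hwx.symm⟩
    by_cases hu : u = c
    · exact .inr (of_eq huv.symm hu)
    by_cases hv : v = c
    · exact .inl (of_eq huv hv)
    by_cases hcu : G.Adj c u
    · exact .inr (of_not_adj huv.symm (fun hcv => hc ⟨hcu, hcv⟩) hv)
    · exact .inl (of_not_adj huv hcu hu)

theorem IsHub.isAdmissible_two [Finite V] {c : V} (h : IsHub G c) : G.IsAdmissible 2 := by
  refine ⟨hubTree G c, isTreeSpanner_of_adj (fun _ _ h' => h'.1) h.isTree_hubTree ?_⟩
  intro u v huv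
  by_cases hc : G.Adj c u ∧ G.Adj c v
  · exact dist_le (.cons (hubTree_adj_center hc.1).symm (.cons (hubTree_adj_center hc.2) .nil))
  · exact (dist_eq_one_iff_adj.2 (⟨huv, hc⟩ : (hubTree G c).Adj u v)).trans_le one_le_two

theorem isAdmissible_two_iff_exists_isHub [DecidableEq V] [Finite V] (hG : G.IsP4Tidy) :
    G.IsAdmissible 2 ↔ ∃ c, IsHub G c :=
  ⟨fun ⟨_, hT⟩ => exists_isHub hG hT, fun ⟨_, hc⟩ => hc.isAdmissible_two⟩

end TwoAdmissibility

/-! ### Computations of a random access machine -/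

namespace RAM

variable {P : Program} {input : List ℕ} {s t u : Config} {k l : ℕ} {b : Bool}

/-- `P` leads from the configuration `s` to `t` in at most `k` steps. -/
def Reaches (P : Program) (k : ℕ) (s t : Config) : Prop :=
  ∃ j ≤ k, (step P)^[j] s = t

theorem Reaches.trans (h : Reaches P k s t) (h' : Reaches P l t u) : Reaches P (k + l) s u := by
  obtain ⟨i, hi, rfl⟩ := h
  obtain ⟨j, hj, rfl⟩ := h'
  exact ⟨j + i, by lia, Function.iterate_add_apply _ _ _ _⟩

theorem Reaches.mono (h : Reaches P k s t) (hkl : k ≤ l) : Reaches P l s t := by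
  obtain ⟨i, hi, e⟩ := h
  exact ⟨i, hi.trans hkl, e⟩

theorem Reaches.answersWithin (h : Reaches P k (init input) s)
    (hs : P[s.pc]? = some (Instr.halt b)) : AnswersWithin P input k b := by
  obtain ⟨j, hj, rfl⟩ := h
  exact ⟨j, hj, hs⟩

theorem step_of_getElem?_eq {i : Instr} (h : P[s.pc]? = some i) : step P s = i.exec s := by
  simp only [step, h]

section Jumps

variable {r m : ℕ → ℕ} {pc a c : ℕ}

theorem reaches_jump (h : P[pc]? = some (.jump l)) : Reaches P 1 ⟨pc, r, m⟩ ⟨l, r, m⟩ :=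
  ⟨1, le_rfl, step_of_getElem?_eq (s := ⟨pc, r, m⟩) h⟩

theorem reaches_jumpLT_of_lt (h : P[pc]? = some (.jumpLT a c l)) (hlt : r a < r c) :
    Reaches P 1 ⟨pc, r, m⟩ ⟨l, r, m⟩ :=
  ⟨1, le_rfl, (step_of_getElem?_eq h).trans (by simp only [Instr.exec, if_pos hlt])⟩

theorem reaches_jumpLT_of_le (h : P[pc]? = some (.jumpLT a c l)) (hle : r c ≤ r a) :
    Reaches P 1 ⟨pc, r, m⟩ ⟨pc + 1, r, m⟩ :=
  ⟨1, le_rfl, (step_of_getElem?_eq h).trans (by simp only [Instr.exec, if_neg hle.not_gt])⟩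

end Jumps

theorem run_succ (P : Program) (input : List ℕ) (k : ℕ) :
    run P input (k + 1) = step P (run P input k) :=
  Function.iterate_succ_apply' _ _ _

theorem run_eq_of_halt (h : P[(run P input k).pc]? = some (Instr.halt b)) (hkl : k ≤ l) :
    run P input l = run P input k := by
  induction l, hkl using Nat.le_induction with
  | base => rfl
  | succ l _ ih => rw [run_succ, ih, step_of_getElem?_eq h, Instr.exec]

theorem AnswersWithin.wordsBounded {B : ℕ → ℕ} (h : AnswersWithin P input k b) (hB : Monotone B)
    (hle : ∀ j i, (run P input j).reg i ≤ B j ∧ (run P input j).mem i ≤ B j) :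
    WordsBounded P input (B k) := by
  obtain ⟨j, hj, hhalt⟩ := h
  intro l i
  obtain ⟨l', hl', hrun⟩ : ∃ l' ≤ k, run P input l = run P input l' := by
    rcases le_total l j with hlj | hjl
    · exact ⟨l, hlj.trans hj, rfl⟩
    · exact ⟨j, hj, run_eq_of_halt hhalt hjl⟩
  rw [hrun]
  exact ⟨(hle l' i).1.trans (hB hl'), (hle l' i).2.trans (hB hl')⟩

/-! ### Growth of the words -/

variable {R : Set ℕ} {q M K : ℕ}

/-- `i` does not change the registers in `R`, loads no constant but `0`, adds only the contents of
registers in `R`, and does not jump to the first `q` instructions. Such instructions let the words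
grow by at most the largest content of a register in `R` per step. -/
def Instr.IsTame (R : Set ℕ) (q : ℕ) : Instr → Prop
  | .const d k => d ∉ R ∧ k = 0
  | .add d _ b => d ∉ R ∧ b ∈ R
  | .sub d _ _ => d ∉ R
  | .load d _ => d ∉ R
  | .store _ _ => True
  | .jump l => q ≤ l
  | .jumpLT _ _ l => q ≤ l
  | .halt _ => True

/-- The first `q` instructions are done, the words in the registers in `R` are at most `M`, and all
words are at most `K`. -/
structure Config.IsTame (R : Set ℕ) (q M K : ℕ) (s : Config) : Prop where
  le_pc : q ≤ s.pc
  reg_le_of_mem : ∀ i ∈ R, s.reg i ≤ M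
  reg_le : ∀ i, s.reg i ≤ K
  mem_le : ∀ i, s.mem i ≤ K

theorem update_le {f : ℕ → ℕ} {d x : ℕ} (hf : ∀ i, f i ≤ K) (hx : x ≤ K) (i : ℕ) :
    Function.update f d x i ≤ K := by
  rw [Function.update_apply]
  split_ifs
  exacts [hx, hf i]

theorem Config.IsTame.mono (hs : s.IsTame R q M K) (hkl : K ≤ l) : s.IsTame R q M l :=
  ⟨hs.le_pc, hs.reg_le_of_mem, fun i => (hs.reg_le i).trans hkl, fun i => (hs.mem_le i).trans hkl⟩

theorem Config.IsTame.update_reg {d x : ℕ} (hs : s.IsTame R q M K) (hd : d ∉ R) (hx : x ≤ K) :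
    Config.IsTame R q M K ⟨s.pc + 1, Function.update s.reg d x, s.mem⟩ where
  le_pc := hs.le_pc.trans (Nat.le_succ _)
  reg_le_of_mem i hi := by
    simpa only [Function.update_of_ne (ne_of_mem_of_not_mem hi hd)] using hs.reg_le_of_mem i hi
  reg_le := update_le hs.reg_le hx
  mem_le := hs.mem_le

theorem Config.IsTame.exec {i : Instr} (hs : s.IsTame R q M K) (hi : i.IsTame R q) :
    (i.exec s).IsTame R q M (K + M) := by
  have hs' := hs.mono (Nat.le_add_right K M)
  match i, hi with
  | .const d k, ⟨hd, hk⟩ => exact hs'.update_reg hd (hk ▸ Nat.zero_le _)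
  | .add d a b, ⟨hd, hb⟩ =>
    exact hs'.update_reg hd (add_le_add (hs.reg_le a) (hs.reg_le_of_mem b hb))
  | .sub d a b, hd => exact hs'.update_reg hd ((Nat.sub_le _ _).trans (hs'.reg_le a))
  | .load d a, hd => exact hs'.update_reg hd (hs'.mem_le _)
  | .store a k, _ =>
    exact ⟨hs.le_pc.trans (Nat.le_succ _), hs.reg_le_of_mem, hs'.reg_le,
      update_le hs'.mem_le (hs'.reg_le k)⟩
  | .jump l, hl => exact ⟨hl, hs.reg_le_of_mem, hs'.reg_le, hs'.mem_le⟩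
  | .jumpLT a b l, hl =>
    refine ⟨?_, hs.reg_le_of_mem, hs'.reg_le, hs'.mem_le⟩
    have hpc := hs.le_pc.trans (Nat.le_succ _)
    simp only [Instr.exec]
    split_ifs
    exacts [hl, hpc]
  | .halt _, _ => exact hs'

theorem Config.IsTame.step (hs : s.IsTame R q M K) (hP : ∀ i ∈ P.drop q, i.IsTame R q) :
    (step P s).IsTame R q M (K + M) := by
  match h : P[s.pc]? with
  | some i =>
    rw [step_of_getElem?_eq h]
    refine hs.exec (hP i (List.mem_of_getElem? (i := s.pc - q) ?_))
    rw [List.getElem?_drop, Nat.add_sub_cancel' hs.le_pc, h]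
  | none =>
    simp only [RAM.step, h]
    exact hs.mono (Nat.le_add_right K M)

theorem Config.IsTame.run_add {j : ℕ} (h : (run P input j).IsTame R q M K)
    (hP : ∀ i ∈ P.drop q, i.IsTame R q) (k : ℕ) :
    (run P input (j + k)).IsTame R q M (K + k * M) := by
  induction k with
  | zero => simpa using h
  | succ k ih =>
    rw [← add_assoc, run_succ, Nat.succ_mul, ← add_assoc]
    exact ih.step hP

end RAM

/-! ### Recognizing pendant vertices and hubs -/

namespace TwoAdmissibility

open SimpleGraph RAM

section Counting

variable {V : Type*} {G : SimpleGraph V}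

theorem isPendant_iff_one_lt_ncard [Finite V] {w : V} :
    IsPendant G w ↔ ∃ p, G.neighborSet w = {p} ∧ 1 < (G.neighborSet p).ncard := by
  refine exists_congr fun p => ?_
  rw [show (∀ q, G.Adj w q ↔ q = p) ↔ G.neighborSet w = {p} from Set.ext_iff.symm]
  refine and_congr_right fun hw => ?_
  have hpw : w ∈ G.neighborSet p := G.adj_symm (hw.ge rfl)
  constructor
  · rintro ⟨q, hqw, hpq⟩
    exact (Set.one_lt_ncard).2 ⟨q, hpq, w, hpw, hqw⟩
  · intro h
    obtain ⟨q, hpq, hqw⟩ := Set.exists_ne_of_one_lt_ncard h w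
    exact ⟨q, hqw, hpq⟩

theorem IsPendant.not_adj {u v : V} (hu : IsPendant G u) (hv : IsPendant G v) : ¬G.Adj u v := by
  intro h
  obtain ⟨p, hp, q, hq, hpq⟩ := hu
  obtain ⟨p', hp', -⟩ := hv
  obtain rfl := (hp v).1 h
  exact hq (((hp' q).1 hpq).trans ((hp' u).1 h.symm).symm)

/-- The set of pendant vertices in the closed neighbourhood of `x`. -/
def pendantsNear (G : SimpleGraph V) (x : V) : Set V :=
  {u | IsPendant G u ∧ (u = x ∨ G.Adj u x)}

theorem IsPendant.pendantsNear_subset {v : V} (hv : IsPendant G v) : pendantsNear G v ⊆ {v} := by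
  rintro u ⟨hu, rfl | huv⟩
  exacts [rfl, absurd huv (hu.not_adj hv)]

theorem isHub_iff_subset {c : V} :
    IsHub G c ↔ {w | IsPendant G w}ᶜ ⊆ insert c (G.neighborSet c) := by
  simp only [IsHub, Set.subset_def, Set.mem_compl_iff, Set.mem_ofPred_eq, Set.mem_insert_iff,
    mem_neighborSet]
  grind

theorem isHub_iff_ncard [Finite V] {c : V} :
    IsHub G c ↔ (G.neighborSet c).ncard + 1 - (pendantsNear G c).ncard =
      Nat.card V - {w | IsPendant G w}.ncard := by
  set S : Set V := {w | IsPendant G w}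
  set N : Set V := insert c (G.neighborSet c)
  have hN : N.ncard = (G.neighborSet c).ncard + 1 :=
    Set.ncard_insert_of_notMem (G.loopless.irrefl c)
  have hnear : pendantsNear G c = N ∩ S := by
    ext u
    simp only [pendantsNear, N, S, Set.mem_inter_iff, Set.mem_insert_iff, mem_neighborSet,
      Set.mem_ofPred_eq, G.adj_comm c]
    tauto
  have hdiff : N.ncard - (N ∩ S).ncard = (N ∩ Sᶜ).ncard := by
    have := Set.ncard_inter_add_ncard_sdiff_eq_ncard N S
    rw [← Set.sdiff_eq]
    lia
  have hcompl : Nat.card V - S.ncard = Sᶜ.ncard := by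
    have := Set.ncard_add_ncard_compl S
    lia
  rw [← hN, hnear, hdiff, hcompl, isHub_iff_subset, ← Set.inter_eq_right]
  exact ⟨congrArg Set.ncard, fun h => Set.eq_of_subset_of_ncard_le Set.inter_subset_right h.ge⟩

variable {n k : ℕ} {S : Set (Fin n)}

/-- The number of elements of `S` below `k`. -/
noncomputable def countBelow (S : Set (Fin n)) (k : ℕ) : ℕ :=
  {u ∈ S | (u : ℕ) < k}.ncard

theorem countBelow_zero : countBelow S 0 = 0 := by
  simp [countBelow]

theorem countBelow_of_le (hk : n ≤ k) : countBelow S k = S.ncard := by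
  simp [countBelow, fun u : Fin n => u.2.trans_le hk]

theorem countBelow_eq_zero_of_subset {v : Fin n} (hS : S ⊆ {v}) : countBelow S v = 0 := by
  rw [countBelow, Set.ncard_eq_zero, Set.sep_eq_empty_iff_mem_false]
  intro u hu
  simp [Set.mem_singleton_iff.1 (hS hu)]

theorem countBelow_succ_of_notMem {v : Fin n} (hv : v ∉ S) :
    countBelow S (v + 1) = countBelow S v := by
  unfold countBelow
  congr 1
  ext u
  simp only [Set.mem_sep_iff, Nat.lt_succ_iff_lt_or_eq, ← Fin.ext_iff]
  grind

theorem countBelow_succ_of_mem {v : Fin n} (hv : v ∈ S) :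
    countBelow S (v + 1) = countBelow S v + 1 := by
  unfold countBelow
  rw [← Set.ncard_insert_of_notMem (a := v) (by simp)]
  congr 1
  ext u
  simp only [Set.mem_sep_iff, Set.mem_insert_iff, Nat.lt_succ_iff_lt_or_eq, ← Fin.ext_iff]
  grind

end Counting

/-! ### Adjacency lists -/

section AdjacencyLists

variable {n : ℕ} {G : SimpleGraph (Fin n)} {L : Fin n → List (Fin n)}

theorem coe_toFinset_of_isAdjList (hL : G.IsAdjList L) (v : Fin n) :
    ((L v).toFinset : Set (Fin n)) = G.neighborSet v := by
  ext w
  simp [(hL v).2]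

theorem length_of_isAdjList (hL : G.IsAdjList L) (v : Fin n) :
    (L v).length = (G.neighborSet v).ncard := by
  rw [← coe_toFinset_of_isAdjList hL, Set.ncard_coe_finset, List.toFinset_card_of_nodup (hL v).1]

theorem eq_singleton_iff_of_isAdjList (hL : G.IsAdjList L) {v p : Fin n} :
    L v = [p] ↔ G.neighborSet v = {p} := by
  rw [← coe_toFinset_of_isAdjList hL, ← List.perm_singleton,
    List.perm_ext_iff_of_nodup (hL v).1 (List.nodup_singleton p), Set.ext_iff]
  simp

theorem isPendant_iff_of_isAdjList (hL : G.IsAdjList L) {v : Fin n} :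
    IsPendant G v ↔ ∃ p, L v = [p] ∧ 1 < (L p).length := by
  simp only [isPendant_iff_one_lt_ncard, eq_singleton_iff_of_isAdjList hL, length_of_isAdjList hL]

theorem isHub_iff_of_isAdjList (hL : G.IsAdjList L) {v : Fin n} :
    IsHub G v ↔ (L v).length + 1 - countBelow (pendantsNear G v) n =
      n - countBelow {w | IsPendant G w} n := by
  rw [isHub_iff_ncard, length_of_isAdjList hL, countBelow_of_le le_rfl, countBelow_of_le le_rfl,
    Nat.card_eq_fintype_card, Fintype.card_fin]

theorem length_le_of_isAdjList (hL : G.IsAdjList L) (v : Fin n) : (L v).length ≤ n := by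
  simpa using (hL v).1.length_le_card

variable (L)

/-- The `k`-th entry of the table of addresses in `adjListInput L`. -/
def tableEntry (k : ℕ) : ℕ :=
  n + 2 + ∑ v : Fin n, if (v : ℕ) < k then (L v).length else 0

theorem tableEntry_succ (v : Fin n) :
    tableEntry L (v + 1) = tableEntry L v + (L v).length := by
  have hsplit (u : Fin n) : (if (u : ℕ) < v + 1 then (L u).length else 0) =
      (if (u : ℕ) < v then (L u).length else 0) + if u = v then (L u).length else 0 := by
    grind
  simp only [tableEntry, hsplit, Finset.sum_add_distrib, Finset.sum_ite_eq', Finset.mem_univ,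
    if_true, add_assoc]

theorem tableEntry_mono : Monotone (tableEntry L) := by
  intro k l h
  refine Nat.add_le_add_left (Finset.sum_le_sum fun v _ => ?_) _
  split_ifs <;> lia

theorem lt_tableEntry (k : ℕ) : n + 1 < tableEntry L k := by
  unfold tableEntry
  lia

theorem tableEntry_le (hL : ∀ v, (L v).length ≤ n) (k : ℕ) : tableEntry L k ≤ (n + 2) ^ 2 := by
  have hsum : (∑ v : Fin n, if (v : ℕ) < k then (L v).length else 0) ≤ n * n := by
    simpa using Finset.sum_le_card_nsmul Finset.univ
      (fun v : Fin n => if (v : ℕ) < k then (L v).length else 0) n fun v _ => by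
        split_ifs
        exacts [hL v, Nat.zero_le _]
  unfold tableEntry
  nlinarith

theorem adjListInput_getD_zero : (adjListInput L).getD 0 0 = n := by
  simp [adjListInput]

theorem adjListInput_getD_succ {k : ℕ} (hk : k ≤ n) :
    (adjListInput L).getD (k + 1) 0 = tableEntry L k := by
  unfold adjListInput
  rw [List.getD_append _ _ _ _ (by simpa using hk), List.getD_append_right _ _ _ _ (by simp)]
  simp [List.getD_eq_getElem?_getD, Nat.lt_succ_of_le hk, tableEntry]

theorem adjListInput_length : (adjListInput L).length = tableEntry L n := by
  simp only [adjListInput, tableEntry, List.length_append, List.length_singleton, List.length_map,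
    List.length_range, List.length_flatten, List.map_ofFn, Function.comp_def, List.sum_ofFn,
    Fin.is_lt, if_true]
  ring

theorem getElem?_flatten_of_getElem?_eq_cons {α : Type*} {ls : List (List α)} {k : ℕ} {a : α}
    {l : List α} (h : ls[k]? = some (a :: l)) :
    ls.flatten[((ls.map List.length).take k).sum]? = some a := by
  obtain ⟨hk, hl⟩ := List.getElem?_eq_some_iff.1 h
  rw [← Nat.add_zero (List.sum _), ← List.getElem?_drop, List.drop_sum_flatten,
    List.drop_eq_getElem_cons hk, hl]
  rfl

theorem adjListInput_getD_tableEntry {v p : Fin n} {l : List (Fin n)} (h : L v = p :: l) :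
    (adjListInput L).getD (tableEntry L v) 0 = p := by
  unfold adjListInput
  set ls : List (List ℕ) := List.ofFn fun v : Fin n => (L v).map fun w : Fin n => (w : ℕ) with hls
  have hsum : ((ls.map List.length).take v).sum = tableEntry L v - (1 + (n + 1)) := by
    rw [hls, List.map_ofFn, List.sum_take_ofFn, Finset.sum_filter]
    simp [tableEntry, add_comm 1]
  have hget : ls[(v : ℕ)]? = some ((p : ℕ) :: l.map fun w : Fin n => (w : ℕ)) := by
    simp [hls, h]
  rw [List.getD_append_right _ _ _ _ (by simp [tableEntry]), List.getD_eq_getElem?_getD,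
    List.length_append, List.length_singleton, List.length_map, List.length_range, ← hsum,
    getElem?_flatten_of_getElem?_eq_cons hget, Option.getD_some]

theorem le_of_mem_adjListInput (hL : ∀ v, (L v).length ≤ n) {a : ℕ} (ha : a ∈ adjListInput L) :
    a ≤ (n + 2) ^ 2 := by
  simp only [adjListInput, List.mem_append, List.mem_singleton, List.mem_map, List.mem_flatten,
    List.mem_ofFn] at ha
  have hn : n ≤ (n + 2) ^ 2 := by nlinarith
  rcases ha with (rfl | ⟨k, -, rfl⟩) | ⟨_, ⟨v, rfl⟩, hw⟩
  · exact hn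
  · exact tableEntry_le L hL k
  · obtain ⟨w, -, rfl⟩ := List.mem_map.1 hw
    exact w.2.le.trans hn

theorem adjListInput_getD_le (hL : ∀ v, (L v).length ≤ n) (i : ℕ) :
    (adjListInput L).getD i 0 ≤ (n + 2) ^ 2 := by
  rcases lt_or_ge i (adjListInput L).length with hi | hi
  · rw [List.getD_eq_getElem _ _ hi]
    exact le_of_mem_adjListInput L hL (List.getElem_mem hi)
  · rw [List.getD_eq_default _ _ hi]
    exact Nat.zero_le _

end AdjacencyLists

/-! ### The program -/

/-- Decides whether the graph given by its adjacency lists has a hub. Register 1 holds `1`,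
register 2 the number of vertices, register 3 the address behind the input, where a table with an
entry for every vertex is kept, and register 4 runs through the vertices. The first loop counts the
pendant vertices in register 5, and the pendant vertices of every closed neighbourhood in the table;
the second loop looks for a hub. -/
def hubProgram : Program :=
  [.const 1 1,
   .load 2 0,
   .add 3 2 1,
   .load 3 3,
   -- line 4: head of the first loop
   .jumpLT 4 2 6,
   .jump 30,
   .add 6 4 1,
   .load 7 6,
   .add 6 6 1,
   .load 8 6,
   .sub 8 8 7,
   .jumpLT 1 8 28,
   .jumpLT 8 1 28,
   .load 7 7,
   .add 6 7 1,
   .load 8 6,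
   .add 6 6 1,
   .load 6 6,
   .sub 6 6 8,
   .jumpLT 1 6 21,
   .jump 28,
   -- line 21: the current vertex is pendant
   .add 5 5 1,
   .add 6 4 3,
   .store 6 1,
   .add 6 7 3,
   .load 8 6,
   .add 8 8 1,
   .store 6 8,
   -- line 28: next vertex
   .add 4 4 1,
   .jump 4,
   -- line 30: the second loop is prepared
   .const 4 0,
   .sub 5 2 5,
   -- line 32: head of the second loop
   .jumpLT 4 2 34,
   .halt false,
   .add 6 4 1,
   .load 7 6,
   .add 6 6 1,
   .load 8 6,
   .sub 8 8 7,
   .add 8 8 1,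
   .add 6 4 3,
   .load 6 6,
   .sub 8 8 6,
   .jumpLT 8 5 46,
   .jumpLT 5 8 46,
   .halt true,
   -- line 46: next vertex
   .add 4 4 1,
   .jump 32]

section Words

variable {input : List ℕ} {M : ℕ}

theorem isTame_of_mem_drop_hubProgram : ∀ i ∈ hubProgram.drop 4, i.IsTame {1, 3} 4 := by
  simp [hubProgram, Instr.IsTame]

theorem hubProgram_run_le_of_le_four (hM : input.getD 0 0 + 1 ≤ M)
    (hinput : ∀ i, input.getD i 0 ≤ M) {k : ℕ} (hk : k ≤ 4) (i : ℕ) :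
    (run hubProgram input k).reg i ≤ M ∧ (run hubProgram input k).mem i ≤ M := by
  have hM1 : 1 ≤ M := le_of_add_le_right hM
  have h0 : ∀ i, (init input).reg i ≤ M := fun _ => Nat.zero_le M
  have h1 := update_le (d := 1) h0 hM1
  have h2 := update_le (d := 2) h1 (hinput 0)
  have h3 := update_le (d := 3) h2 hM
  have h4 := update_le (d := 3) h3 (hinput (input.getD 0 0 + 1))
  interval_cases k
  exacts [⟨h0 i, hinput i⟩, ⟨h1 i, hinput i⟩, ⟨h2 i, hinput i⟩, ⟨h3 i, hinput i⟩,
    ⟨h4 i, hinput i⟩]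

theorem hubProgram_run_le (hM : input.getD 0 0 + 1 ≤ M) (hinput : ∀ i, input.getD i 0 ≤ M)
    (k i : ℕ) : (run hubProgram input k).reg i ≤ (k + 1) * M ∧
      (run hubProgram input k).mem i ≤ (k + 1) * M := by
  have hstart {k : ℕ} (hk : k ≤ 4) := hubProgram_run_le_of_le_four hM hinput hk
  rcases le_total k 4 with hk | hk
  · have hle : M ≤ (k + 1) * M := Nat.le_mul_of_pos_left M k.succ_pos
    exact ⟨(hstart hk i).1.trans hle, (hstart hk i).2.trans hle⟩
  · obtain ⟨j, rfl⟩ := Nat.exists_eq_add_of_le hk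
    have hfour : (run hubProgram input 4).IsTame {1, 3} 4 M M :=
      ⟨le_rfl, fun i _ => (hstart le_rfl i).1, fun i => (hstart le_rfl i).1,
        fun i => (hstart le_rfl i).2⟩
    have htame := hfour.run_add isTame_of_mem_drop_hubProgram j
    have hle : M + j * M ≤ (4 + j + 1) * M := by nlinarith
    exact ⟨(htame.reg_le i).trans hle, (htame.mem_le i).trans hle⟩

theorem hubProgram_wordsBounded {T : ℕ} {b : Bool} (h : AnswersWithin hubProgram input T b)
    (hM : input.getD 0 0 + 1 ≤ M) (hinput : ∀ i, input.getD i 0 ≤ M) :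
    WordsBounded hubProgram input ((T + 1) * M) :=
  h.wordsBounded (B := fun k => (k + 1) * M) (fun _ _ hkl =>
    Nat.mul_le_mul_right M (Nat.succ_le_succ hkl)) (hubProgram_run_le hM hinput)

end Words

/-! ### Straight-line parts of the program -/

section Blocks

variable (r m : ℕ → ℕ)

theorem exists_reaches_read_degree : ∃ r', Reaches hubProgram 5 ⟨6, r, m⟩ ⟨11, r', m⟩ ∧
    (∀ i < 6, r' i = r i) ∧ r' 7 = m (r 4 + r 1) ∧
    r' 8 = m (r 4 + r 1 + r 1) - m (r 4 + r 1) := by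
  refine ⟨_, ⟨5, le_rfl, rfl⟩, ?_, rfl, rfl⟩
  intro i hi
  interval_cases i <;> rfl

theorem exists_reaches_read_neighbour_degree : ∃ r', Reaches hubProgram 6 ⟨13, r, m⟩ ⟨19, r', m⟩ ∧
    (∀ i < 6, r' i = r i) ∧ r' 7 = m (r 7) ∧
    r' 6 = m (m (r 7) + r 1 + r 1) - m (m (r 7) + r 1) := by
  refine ⟨_, ⟨6, le_rfl, rfl⟩, ?_, rfl, rfl⟩
  intro i hi
  interval_cases i <;> rfl

theorem exists_reaches_record_pendant : ∃ r', Reaches hubProgram 9 ⟨21, r, m⟩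
    ⟨4, r', Function.update (Function.update m (r 4 + r 3) (r 1)) (r 7 + r 3)
      (Function.update m (r 4 + r 3) (r 1) (r 7 + r 3) + r 1)⟩ ∧
    (∀ i < 4, r' i = r i) ∧ r' 4 = r 4 + r 1 ∧ r' 5 = r 5 + r 1 := by
  refine ⟨_, ⟨9, le_rfl, rfl⟩, ?_, rfl, rfl⟩
  intro i hi
  interval_cases i <;> rfl

theorem exists_reaches_next_of_first_loop : ∃ r', Reaches hubProgram 2 ⟨28, r, m⟩ ⟨4, r', m⟩ ∧
    (∀ i < 4, r' i = r i) ∧ r' 4 = r 4 + r 1 ∧ r' 5 = r 5 := by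
  refine ⟨_, ⟨2, le_rfl, rfl⟩, ?_, rfl, rfl⟩
  intro i hi
  interval_cases i <;> rfl

theorem exists_reaches_second_loop : ∃ r', Reaches hubProgram 2 ⟨30, r, m⟩ ⟨32, r', m⟩ ∧
    (∀ i < 4, r' i = r i) ∧ r' 4 = 0 ∧ r' 5 = r 2 - r 5 := by
  refine ⟨_, ⟨2, le_rfl, rfl⟩, ?_, rfl, rfl⟩
  intro i hi
  interval_cases i <;> rfl

theorem exists_reaches_compute_hub_test : ∃ r', Reaches hubProgram 9 ⟨34, r, m⟩ ⟨43, r', m⟩ ∧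
    (∀ i < 6, r' i = r i) ∧
    r' 8 = m (r 4 + r 1 + r 1) - m (r 4 + r 1) + r 1 - m (r 4 + r 3) := by
  refine ⟨_, ⟨9, le_rfl, rfl⟩, ?_, rfl⟩
  intro i hi
  interval_cases i <;> rfl

theorem exists_reaches_next_of_second_loop : ∃ r', Reaches hubProgram 2 ⟨46, r, m⟩ ⟨32, r', m⟩ ∧
    (∀ i < 4, r' i = r i) ∧ r' 4 = r 4 + r 1 ∧ r' 5 = r 5 := by
  refine ⟨_, ⟨2, le_rfl, rfl⟩, ?_, rfl, rfl⟩
  intro i hi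
  interval_cases i <;> rfl

end Blocks

/-! ### Loop invariants -/

variable {n k l : ℕ} {G : SimpleGraph (Fin n)} {L : Fin n → List (Fin n)} {v p : Fin n}
  {r r' m : ℕ → ℕ}

/-- The memory `m` begins with the adjacency lists `L`. -/
def HoldsInput (L : Fin n → List (Fin n)) (m : ℕ → ℕ) : Prop :=
  ∀ a < tableEntry L n, m a = (adjListInput L).getD a 0

/-- The memory contains the input, followed by the numbers of pendant vertices below `k` in the
closed neighbourhoods. -/
structure MemInv (G : SimpleGraph (Fin n)) (L : Fin n → List (Fin n)) (k : ℕ) (m : ℕ → ℕ) :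
    Prop where
  input : HoldsInput L m
  near : ∀ x : Fin n, m (x + tableEntry L n) = countBelow (pendantsNear G x) k

/-- The registers 1 to 4 hold `1`, the number of vertices, the address behind the input and `k`. -/
structure RegInv (L : Fin n → List (Fin n)) (k : ℕ) (r : ℕ → ℕ) : Prop where
  one : r 1 = 1
  size : r 2 = n
  base : r 3 = tableEntry L n
  vertex : r 4 = k

/-- What holds at the head of the first loop, before the vertex `k` is treated. -/
structure CountInv (G : SimpleGraph (Fin n)) (L : Fin n → List (Fin n)) (k : ℕ)
    (r m : ℕ → ℕ) : Prop where
  reg : RegInv L k r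
  mem : MemInv G L k m
  count : r 5 = countBelow {w | IsPendant G w} k

/-- What holds at the head of the second loop, before the vertex `k` is treated. -/
structure SearchInv (G : SimpleGraph (Fin n)) (L : Fin n → List (Fin n)) (k : ℕ)
    (r m : ℕ → ℕ) : Prop where
  reg : RegInv L k r
  mem : MemInv G L n m
  count : r 5 = n - countBelow {w | IsPendant G w} n

theorem RegInv.of_eq (h : RegInv L k r) (hr : ∀ i < 4, r' i = r i) (h4 : r' 4 = l) :
    RegInv L l r' :=
  ⟨(hr 1 (by lia)).trans h.one, (hr 2 (by lia)).trans h.size, (hr 3 (by lia)).trans h.base, h4⟩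

theorem RegInv.congr (h : RegInv L k r) (hr : ∀ i < 6, r' i = r i) : RegInv L k r' :=
  h.of_eq (fun i hi => hr i (by lia)) ((hr 4 (by lia)).trans h.vertex)

theorem HoldsInput.table (h : HoldsInput L m) (hk : k ≤ n) : m (k + 1) = tableEntry L k := by
  rw [h _ ((Nat.succ_le_succ hk).trans_lt (lt_tableEntry L n)), adjListInput_getD_succ L hk]

theorem HoldsInput.degree (h : HoldsInput L m) (v : Fin n) :
    m ((v : ℕ) + 1 + 1) - m ((v : ℕ) + 1) = (L v).length := by
  rw [h.table v.2.le, h.table v.2, tableEntry_succ, Nat.add_sub_cancel_left]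

theorem HoldsInput.neighbour (h : HoldsInput L m) (hp : L v = [p]) : m (tableEntry L v) = p := by
  have hlt : tableEntry L v < tableEntry L (v + 1) := by
    rw [tableEntry_succ, hp]
    exact Nat.lt_succ_self _
  rw [h _ (hlt.trans_le (tableEntry_mono L v.2)), adjListInput_getD_tableEntry L hp]

/-! ### The first loop -/

theorem exists_reaches_length (hr : RegInv L v r) (hm : HoldsInput L m) :
    ∃ r', Reaches hubProgram 6 ⟨4, r, m⟩ ⟨11, r', m⟩ ∧ (∀ i < 6, r' i = r i) ∧
      r' 7 = tableEntry L v ∧ r' 8 = (L v).length := by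
  have hlt : r 4 < r 2 := by simp only [hr.vertex, hr.size, v.2]
  obtain ⟨r', hreach, hr', h7, h8⟩ := exists_reaches_read_degree r m
  rw [hr.vertex, hr.one] at h7 h8
  exact ⟨r', (reaches_jumpLT_of_lt rfl hlt).trans hreach, hr', h7.trans (hm.table v.2.le),
    h8.trans (hm.degree v)⟩

theorem exists_reaches_of_length_ne_one (hr : RegInv L v r) (hm : HoldsInput L m)
    (hv : (L v).length ≠ 1) :
    ∃ r', Reaches hubProgram 8 ⟨4, r, m⟩ ⟨28, r', m⟩ ∧ ∀ i < 6, r' i = r i := by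
  obtain ⟨r', hreach, hr', -, h8⟩ := exists_reaches_length hr hm
  rw [← h8, ← (hr.congr hr').one] at hv
  refine ⟨r', ?_, hr'⟩
  rcases hv.lt_or_gt with hlt | hgt
  · exact (hreach.trans (reaches_jumpLT_of_le rfl hlt.le)).trans (reaches_jumpLT_of_lt rfl hlt)
  · exact (hreach.trans (reaches_jumpLT_of_lt rfl hgt)).mono (by lia)

theorem exists_reaches_length_neighbour (hr : RegInv L v r) (hm : HoldsInput L m)
    (hp : L v = [p]) :
    ∃ r', Reaches hubProgram 14 ⟨4, r, m⟩ ⟨19, r', m⟩ ∧ (∀ i < 6, r' i = r i) ∧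
      r' 7 = p ∧ r' 6 = (L p).length := by
  obtain ⟨r₁, hreach₁, hr₁, h7, h8⟩ := exists_reaches_length hr hm
  obtain ⟨r₂, hreach₂, hr₂, h7', h6⟩ := exists_reaches_read_neighbour_degree r₁ m
  have heq : r₁ 8 = r₁ 1 := by rw [h8, hp, (hr.congr hr₁).one, List.length_singleton]
  rw [h7, hm.neighbour hp] at h7' h6
  rw [(hr.congr hr₁).one, hm.degree] at h6
  exact ⟨r₂, ((hreach₁.trans (reaches_jumpLT_of_le rfl heq.le)).trans
    (reaches_jumpLT_of_le rfl heq.ge)).trans hreach₂, fun i hi => (hr₂ i hi).trans (hr₁ i hi),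
    h7', h6⟩

theorem exists_reaches_of_not_isPendant (hL : G.IsAdjList L) (hr : RegInv L v r)
    (hm : HoldsInput L m) (hv : ¬IsPendant G v) :
    ∃ r', Reaches hubProgram 16 ⟨4, r, m⟩ ⟨28, r', m⟩ ∧ ∀ i < 6, r' i = r i := by
  by_cases hlen : (L v).length = 1
  · obtain ⟨p, hp⟩ := List.length_eq_one_iff.1 hlen
    obtain ⟨r', hreach, hr', -, h6⟩ := exists_reaches_length_neighbour hr hm hp
    have hle : r' 6 ≤ r' 1 := by
      rw [h6, (hr.congr hr').one, ← not_lt]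
      exact fun hlt => hv ((isPendant_iff_of_isAdjList hL).2 ⟨p, hp, hlt⟩)
    exact ⟨r', (hreach.trans (reaches_jumpLT_of_le rfl hle)).trans (reaches_jump rfl), hr'⟩
  · obtain ⟨r', hreach, hr'⟩ := exists_reaches_of_length_ne_one hr hm hlen
    exact ⟨r', hreach.mono (by lia), hr'⟩

theorem exists_reaches_of_isPendant (hL : G.IsAdjList L) (hr : RegInv L v r)
    (hm : HoldsInput L m) (hv : IsPendant G v) :
    ∃ (p : Fin n) (r' : ℕ → ℕ), L v = [p] ∧ r' 7 = p ∧
      Reaches hubProgram 15 ⟨4, r, m⟩ ⟨21, r', m⟩ ∧ ∀ i < 6, r' i = r i := by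
  obtain ⟨p, hp, hlen⟩ := (isPendant_iff_of_isAdjList hL).1 hv
  obtain ⟨r', hreach, hr', h7, h6⟩ := exists_reaches_length_neighbour hr hm hp
  rw [← h6, ← (hr.congr hr').one] at hlen
  exact ⟨p, r', hp, h7, hreach.trans (reaches_jumpLT_of_lt rfl hlen), hr'⟩

theorem MemInv.succ_of_not_isPendant (h : MemInv G L v m) (hv : ¬IsPendant G v) :
    MemInv G L (v + 1) m :=
  ⟨h.input, fun x => by rw [h.near, countBelow_succ_of_notMem fun hx => hv hx.1]⟩

theorem MemInv.succ_of_isPendant (h : MemInv G L v m) (hL : G.IsAdjList L)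
    (hv : IsPendant G v) (hp : L v = [p]) :
    MemInv G L (v + 1) (Function.update (Function.update m (v + tableEntry L n) 1)
      (p + tableEntry L n)
      (Function.update m (v + tableEntry L n) 1 (p + tableEntry L n) + 1)) := by
  have hadj (x : Fin n) : G.Adj v x ↔ x = p := by rw [← (hL v).2, hp, List.mem_singleton]
  have hne {x y : Fin n} (hxy : x ≠ y) : (x : ℕ) + tableEntry L n ≠ y + tableEntry L n :=
    fun e => hxy (Fin.ext (Nat.add_right_cancel e))
  have hpv : p ≠ v := ((hadj p).2 rfl).ne'
  have hnear (x : Fin n) : v ∈ pendantsNear G x ↔ v = x ∨ x = p :=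
    (and_iff_right hv).trans (or_congr_right (hadj x))
  refine ⟨fun a ha => ?_, fun x => ?_⟩
  · rw [Function.update_of_ne (by lia), Function.update_of_ne (by lia), h.input a ha]
  · by_cases hxp : x = p
    · subst x
      rw [Function.update_self, Function.update_of_ne (hne hpv), h.near,
        countBelow_succ_of_mem ((hnear p).2 (.inr rfl))]
    rw [Function.update_of_ne (hne hxp)]
    by_cases hxv : x = v
    · subst x
      rw [Function.update_self, countBelow_succ_of_mem ((hnear v).2 (.inl rfl)),
        countBelow_eq_zero_of_subset hv.pendantsNear_subset]
    · rw [Function.update_of_ne (hne hxv), h.near, countBelow_succ_of_notMem]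
      simp only [hnear, not_or, Ne.symm hxv, hxp, not_false_eq_true, and_self]

theorem CountInv.exists_reaches_succ (h : CountInv G L v r m) (hL : G.IsAdjList L) :
    ∃ r' m', Reaches hubProgram 24 ⟨4, r, m⟩ ⟨4, r', m'⟩ ∧ CountInv G L (v + 1) r' m' := by
  by_cases hv : IsPendant G v
  · obtain ⟨p, r₁, hp, h7, hreach₁, hr₁⟩ := exists_reaches_of_isPendant hL h.reg h.mem.input hv
    obtain ⟨r₂, hreach₂, hr₂, h4, h5⟩ := exists_reaches_record_pendant r₁ m
    have hreg := h.reg.congr hr₁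
    rw [hreg.vertex, hreg.base, hreg.one, h7] at hreach₂
    rw [hreg.vertex, hreg.one] at h4
    refine ⟨r₂, _, hreach₁.trans hreach₂, hreg.of_eq hr₂ h4, h.mem.succ_of_isPendant hL hv hp, ?_⟩
    rw [h5, hreg.one, hr₁ 5 (by lia), h.count, countBelow_succ_of_mem hv]
  · obtain ⟨r₁, hreach₁, hr₁⟩ := exists_reaches_of_not_isPendant hL h.reg h.mem.input hv
    obtain ⟨r₂, hreach₂, hr₂, h4, h5⟩ := exists_reaches_next_of_first_loop r₁ m
    have hreg := h.reg.congr hr₁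
    rw [hreg.vertex, hreg.one] at h4
    refine ⟨r₂, m, (hreach₁.trans hreach₂).mono (by lia), hreg.of_eq hr₂ h4,
      h.mem.succ_of_not_isPendant hv, ?_⟩
    rw [h5, hr₁ 5 (by lia), h.count, countBelow_succ_of_notMem hv]

theorem exists_countInv_zero (G : SimpleGraph (Fin n)) (L : Fin n → List (Fin n)) :
    ∃ r m, Reaches hubProgram 4 (init (adjListInput L)) ⟨4, r, m⟩ ∧ CountInv G L 0 r m := by
  have hsize := adjListInput_getD_zero L
  refine ⟨_, _, ⟨4, le_rfl, rfl⟩, ⟨rfl, hsize, ?_, rfl⟩, ⟨fun a _ => rfl, fun x => ?_⟩,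
    countBelow_zero.symm⟩
  · change (adjListInput L).getD ((adjListInput L).getD 0 0 + 1) 0 = _
    rw [hsize, adjListInput_getD_succ L le_rfl]
  · rw [countBelow_zero]
    exact List.getD_eq_default _ _ (by rw [adjListInput_length]; exact Nat.le_add_left _ _)

theorem exists_countInv (hL : G.IsAdjList L) (hk : k ≤ n) :
    ∃ r m, Reaches hubProgram (4 + 24 * k) (init (adjListInput L)) ⟨4, r, m⟩ ∧
      CountInv G L k r m := by
  induction k with
  | zero => exact exists_countInv_zero G L
  | succ k ih =>
    obtain ⟨r, m, hreach, h⟩ := ih (by lia)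
    obtain ⟨r', m', hreach', h'⟩ := CountInv.exists_reaches_succ (v := ⟨k, hk⟩) h hL
    exact ⟨r', m', hreach.trans hreach', h'⟩

/-! ### The second loop -/

theorem exists_searchInv_zero (hL : G.IsAdjList L) :
    ∃ r m, Reaches hubProgram (8 + 24 * n) (init (adjListInput L)) ⟨32, r, m⟩ ∧
      SearchInv G L 0 r m := by
  obtain ⟨r, m, hreach, h⟩ := exists_countInv hL le_rfl
  have hle : r 2 ≤ r 4 := by rw [h.reg.size, h.reg.vertex]
  obtain ⟨r', hreach', hr', h4, h5⟩ := exists_reaches_second_loop r m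
  refine ⟨r', m, ?_, h.reg.of_eq hr' h4, h.mem, by rw [h5, h.count, h.reg.size]⟩
  exact (((hreach.trans (reaches_jumpLT_of_le rfl hle)).trans (reaches_jump rfl)).trans
    hreach').mono (by lia)

theorem SearchInv.exists_reaches_test (h : SearchInv G L v r m) (hL : G.IsAdjList L) :
    ∃ r', Reaches hubProgram 10 ⟨32, r, m⟩ ⟨43, r', m⟩ ∧ SearchInv G L v r' m ∧
      (IsHub G v ↔ r' 8 = r' 5) := by
  have hlt : r 4 < r 2 := by simp only [h.reg.vertex, h.reg.size, v.2]
  obtain ⟨r', hreach, hr', h8⟩ := exists_reaches_compute_hub_test r m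
  have h5 := (hr' 5 (by lia)).trans h.count
  rw [h.reg.vertex, h.reg.one, h.reg.base, h.mem.input.degree, h.mem.near] at h8
  refine ⟨r', (reaches_jumpLT_of_lt rfl hlt).trans hreach, ⟨h.reg.congr hr', h.mem, h5⟩, ?_⟩
  rw [isHub_iff_of_isAdjList hL, h8, h5]

theorem SearchInv.exists_reaches_succ_of_not_isHub (h : SearchInv G L v r m)
    (hL : G.IsAdjList L) (hv : ¬IsHub G v) :
    ∃ r', Reaches hubProgram 14 ⟨32, r, m⟩ ⟨32, r', m⟩ ∧ SearchInv G L (v + 1) r' m := by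
  obtain ⟨r₁, hreach₁, h₁, hiff⟩ := h.exists_reaches_test hL
  obtain ⟨r₂, hreach₂, hr₂, h4, h5⟩ := exists_reaches_next_of_second_loop r₁ m
  rw [h₁.reg.vertex, h₁.reg.one] at h4
  refine ⟨r₂, ?_, h₁.reg.of_eq hr₂ h4, h.mem, h5.trans h₁.count⟩
  have hjump : Reaches hubProgram 2 ⟨43, r₁, m⟩ ⟨46, r₁, m⟩ := by
    rcases lt_or_gt_of_ne (mt hiff.2 hv) with hlt | hgt
    · exact (reaches_jumpLT_of_lt rfl hlt).mono (by lia)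
    · exact (reaches_jumpLT_of_le rfl hgt.le).trans (reaches_jumpLT_of_lt rfl hgt)
  exact (hreach₁.trans hjump).trans hreach₂

theorem SearchInv.exists_reaches_of_isHub (h : SearchInv G L v r m) (hL : G.IsAdjList L)
    (hv : IsHub G v) : ∃ r', Reaches hubProgram 12 ⟨32, r, m⟩ ⟨45, r', m⟩ := by
  obtain ⟨r', hreach, -, hiff⟩ := h.exists_reaches_test hL
  have heq := hiff.1 hv
  exact ⟨r', (hreach.trans (reaches_jumpLT_of_le rfl heq.ge)).trans
    (reaches_jumpLT_of_le rfl heq.le)⟩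

theorem SearchInv.exists_reaches_halt (h : SearchInv G L k r m) (hL : G.IsAdjList L) {d : ℕ}
    (hd : k + d = n) :
    ∃ b s, Reaches hubProgram (14 * d + 1) ⟨32, r, m⟩ s ∧ hubProgram[s.pc]? = some (.halt b) ∧
      (b = true ↔ ∃ v : Fin n, k ≤ v ∧ IsHub G v) := by
  induction d generalizing k r with
  | zero =>
    have hle : r 2 ≤ r 4 := by rw [h.reg.vertex, h.reg.size, ← hd, add_zero]
    have hno : ¬∃ v : Fin n, k ≤ v ∧ IsHub G v := fun ⟨v, hkv, _⟩ => by lia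
    exact ⟨false, _, reaches_jumpLT_of_le rfl hle, rfl, iff_of_false Bool.false_ne_true hno⟩
  | succ d ih =>
    lift k to Fin n using by lia with v
    by_cases hv : IsHub G v
    · obtain ⟨r', hreach⟩ := h.exists_reaches_of_isHub hL hv
      exact ⟨true, _, hreach.mono (by lia), rfl, iff_of_true rfl ⟨v, le_rfl, hv⟩⟩
    · obtain ⟨r', hreach, h'⟩ := h.exists_reaches_succ_of_not_isHub hL hv
      obtain ⟨b, s, hreach', hs, hiff⟩ := ih h' (by lia)
      refine ⟨b, s, (hreach.trans hreach').mono (by lia), hs, hiff.trans ?_⟩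
      refine exists_congr fun w => and_congr_left fun hw => ?_
      have hwv : (w : ℕ) ≠ v := fun e => hv (Fin.ext e ▸ hw)
      lia

theorem hubProgram_answersWithin (hL : G.IsAdjList L) :
    ∃ b : Bool, AnswersWithin hubProgram (adjListInput L) (38 * (n + 1)) b ∧
      (b = true ↔ ∃ v, IsHub G v) := by
  obtain ⟨r, m, hreach, h⟩ := exists_searchInv_zero hL
  obtain ⟨b, s, hreach', hs, hiff⟩ := h.exists_reaches_halt hL (zero_add n)
  exact ⟨b, ((hreach.trans hreach').mono (by lia)).answersWithin hs, by simpa using hiff⟩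

theorem hubProgram_wordsBounded_adjListInput (hL : G.IsAdjList L) :
    WordsBounded hubProgram (adjListInput L) ((n + 2) ^ 38) := by
  obtain ⟨b, hb, -⟩ := hubProgram_answersWithin hL
  have hsize : (adjListInput L).getD 0 0 + 1 ≤ (n + 2) ^ 2 := by
    rw [adjListInput_getD_zero]
    nlinarith
  have hbound := hubProgram_wordsBounded hb hsize
    (adjListInput_getD_le L (length_le_of_isAdjList hL))
  have hle : (38 * (n + 1) + 1) * (n + 2) ^ 2 ≤ (n + 2) ^ 38 :=
    calc (38 * (n + 1) + 1) * (n + 2) ^ 2 ≤ 2 ^ 6 * (n + 2) * (n + 2) ^ 2 := by gcongr; lia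
      _ ≤ (n + 2) ^ 6 * (n + 2) * (n + 2) ^ 2 := by gcongr; lia
      _ = (n + 2) ^ 9 := by ring
      _ ≤ (n + 2) ^ 38 := by gcongr <;> lia
  exact fun k i => ⟨(hbound k i).1.trans hle, (hbound k i).2.trans hle⟩

end TwoAdmissibility

theorem mainTheorem10 :
    ∃ (P : RAM.Program) (c : ℕ),
      ∀ (n : ℕ) (G : SimpleGraph (Fin n)), G.IsP4Tidy →
        ∀ L : Fin n → List (Fin n), G.IsAdjList L →
          (∃ b : Bool, RAM.AnswersWithin P (adjListInput L) (c * (n + 1)) b ∧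
            (b = true ↔ G.IsAdmissible 2)) ∧
          RAM.WordsBounded P (adjListInput L) ((n + 2) ^ c) := by
  refine ⟨TwoAdmissibility.hubProgram, 38, fun n G hG L hL => ?_⟩
  obtain ⟨b, hb, hiff⟩ := TwoAdmissibility.hubProgram_answersWithin hL
  exact ⟨⟨b, hb, hiff.trans (TwoAdmissibility.isAdmissible_two_iff_exists_isHub hG).symm⟩,
    TwoAdmissibility.hubProgram_wordsBounded_adjListInput hL⟩
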